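/- Let $k \in \mathbb{C}$ and let $a = re^{i\theta}$ with $r > 0$ and $0 < \theta < 2\pi$. Throughout, $\log$ of the numbers $a$ and $a\tan y$ denotes the branch with argument in $[0, 2\pi)$, so that $\log a = \ln r + i\theta$ and $\log(a\tan y) = \ln(r\tan y) + i\theta$ for $0 < y < \pi/2$; all powers $z^w$, in particular $\log^k(a\tan y) = (\log(a\tan y))^k$, are principal powers. For $u \in \mathbb{C}$, $u \neq 0, -1, -2, \dots$, let $\zeta(s,u)$ denote the Hurwitz zeta function, that is, the analytic continuation in $s$ to $\mathbb{C} \setminus \{1\}$ of $\sum_{n=0}^{\infty} (n+u)^{-s}$ $(\operatorname{Re} s > 1)$. Then the integral below converges absolutely and $$\int_{0}^{\pi/2}\cos(2y)\,\log^{k}(a\tan y)\,dy = 2^{k-1}\,k\,\pi^{k}\,i^{k+1}\left[\zeta\left(1-k,\ \frac14-\frac{i\log a}{2\pi}\right)-\zeta\left(1-k,\ \frac34-\frac{i\log a}{2\pi}\right)\right].$$ For $k = 0$, where $1-k=1$ is the pole of both zeta functions, the right-hand side is understood as $0$ (which is also its limit as $k \to 0$). -/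

import Mathlib

/-- `F` is the analytic continuation in `s` of the Hurwitz zeta series with parameter `u`:
`F` is holomorphic on `ℂ \ {1}` and `F s = ∑_{n ≥ 0} (n + u)^{-s}` for `Re s > 1`
(principal powers). -/
def IsHurwitzContinuation (u : ℂ) (F : ℂ → ℂ) : Prop :=
  DifferentiableOn ℂ F {1}ᶜ ∧
    ∀ s : ℂ, 1 < s.re → F s = ∑' n : ℕ, 1 / ((n : ℂ) + u) ^ s

/-- The continuation is unique away from the pole `s = 1`. -/
theorem IsHurwitzContinuation.eqOn {u : ℂ} {F G : ℂ → ℂ}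
    (hF : IsHurwitzContinuation u F) (hG : IsHurwitzContinuation u G) :
    Set.EqOn F G {1}ᶜ := by
  have ho : IsOpen ({1}ᶜ : Set ℂ) := isOpen_compl_singleton
  have hc : IsPreconnected ({1}ᶜ : Set ℂ) :=
    (isConnected_compl_singleton_of_one_lt_rank (by simp) (1 : ℂ)).isPreconnected
  refine (hF.1.analyticOnNhd ho).eqOn_of_preconnected_of_eventuallyEq
    (hG.1.analyticOnNhd ho) hc (z₀ := 2) (by simp) ?_
  have h2 : {s : ℂ | 1 < s.re} ∈ nhds (2 : ℂ) :=
    (isOpen_lt continuous_const Complex.continuous_re).mem_nhds (by simp)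
  filter_upwards [h2] with s hs
  rw [hF.2 s hs, hG.2 s hs]

open Classical in
/-- The Hurwitz zeta function `ζ(s, u)` with complex parameter `u`: the value at `s` of the
analytic continuation to `ℂ \ {1}` of `∑_{n ≥ 0} (n + u)^{-s}`.
(Its value at the pole `s = 1` carries no meaning.) -/
noncomputable def complexHurwitzZeta (s u : ℂ) : ℂ :=
  if h : ∃ F : ℂ → ℂ, IsHurwitzContinuation u F then h.choose s else 0

/-- The branch `log |z| + i arg z` of the logarithm with `0 ≤ arg z < 2π`. -/
noncomputable def branchLog (z : ℂ) : ℂ :=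
  (Real.log ‖z‖ : ℂ) + ((toIcoMod Real.two_pi_pos 0 (Complex.arg z) : ℝ) : ℂ) * Complex.I

/-- `branchLog (r e^{iθ}) = log r + iθ` for `r > 0` and `0 ≤ θ < 2π`. -/
theorem branchLog_polar {r θ : ℝ} (hr : 0 < r) (h0 : 0 ≤ θ) (h2 : θ < 2 * Real.pi) :
    branchLog ((r : ℂ) * Complex.exp ((θ : ℂ) * Complex.I)) =
      (Real.log r : ℂ) + (θ : ℂ) * Complex.I := by
  have hn : ‖(r : ℂ) * Complex.exp ((θ : ℂ) * Complex.I)‖ = r := by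
    rw [norm_mul, Complex.norm_exp_ofReal_mul_I, mul_one, Complex.norm_real,
      Real.norm_of_nonneg hr.le]
  have ha : toIcoMod Real.two_pi_pos 0
      (Complex.arg ((r : ℂ) * Complex.exp ((θ : ℂ) * Complex.I))) = θ := by
    rw [Complex.arg_real_mul _ hr, Complex.arg_exp_mul_I, toIcoMod_toIocMod]
    exact (toIcoMod_eq_self _).2 ⟨h0, by simpa using h2⟩
  rw [branchLog, hn, ha]

open MeasureTheory Set Filter Topology

/-! Put `v = -i log a`, so `Re v = θ > 0` and `log (a tan y) = i (v - i ln tan y)`. The second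
factor lies in the right half-plane, hence the `k`-th power splits as `i ^ k (v - i ln tan y) ^ k`.

For `Re k < 0`, write `(v - iℓ) ^ k` as a Laplace integral and exchange the integrals
(`Gamma_mul_integral_weight_mul_cpow`). This leaves the characteristic function of `ln tan y` under
the weight `cos 2y`, which Beta integrals evaluate as `-(it/2) π / cosh (πt/2)`. Expanded in powers
of `-e^{-πt}` and integrated termwise, it gives an alternating series in `v + π/2 + nπ`
(`integral_weight_mul_cpow_eq_tsum`); its even and odd terms are the two Hurwitz series.

The integral is entire in `k` (`differentiable_integral_weight_mul_cpow`) and the closed form is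
holomorphic off `k = 0`, so the identity theorem extends the formula; at `k = 0` both sides vanish.

The continuation of the Hurwitz series comes from the same machinery, with the logistic variable `ln
(x / (1 - x))` on `(0, 1)` in place of `ln tan y` (Jensen's integral). -/

/-! ### Euler's Gamma integral with complex rate. -/

lemma norm_cpow_mul_exp_neg_mul (a r : ℂ) {t : ℝ} (ht : 0 < t) :
    ‖(t : ℂ) ^ (a - 1) * Complex.exp (-(r * t))‖ =
      t ^ (a.re - 1) * Real.exp (-(r.re * t)) := by
  rw [norm_mul, Complex.norm_cpow_eq_rpow_re_of_pos ht, Complex.norm_exp]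
  simp

lemma integrableOn_rpow_mul_exp_neg_mul {a r : ℝ} (ha : 0 < a) (hr : 0 < r) :
    IntegrableOn (fun t : ℝ => t ^ (a - 1) * Real.exp (-(r * t))) (Ioi 0) := by
  simpa using integrableOn_rpow_mul_exp_neg_mul_rpow (p := 1) (s := a - 1) (by linarith)
    one_pos hr

lemma aestronglyMeasurable_cpow_mul_exp (a r : ℂ) :
    AEStronglyMeasurable (fun t : ℝ => (t : ℂ) ^ (a - 1) * Complex.exp (-(r * t)))
      (volume.restrict (Ioi 0)) :=
  (by fun_prop : Measurable
    (fun t : ℝ => (t : ℂ) ^ (a - 1) * Complex.exp (-(r * t)))).aestronglyMeasurable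

lemma integrableOn_cpow_mul_exp_neg_mul {a r : ℂ} (ha : 0 < a.re) (hr : 0 < r.re) :
    IntegrableOn (fun t : ℝ => (t : ℂ) ^ (a - 1) * Complex.exp (-(r * t))) (Ioi 0) := by
  refine (integrableOn_rpow_mul_exp_neg_mul ha hr).mono' (aestronglyMeasurable_cpow_mul_exp a r) ?_
  filter_upwards [ae_restrict_mem measurableSet_Ioi] with t ht
  exact (norm_cpow_mul_exp_neg_mul a r ht).le

lemma hasDerivAt_integral_cpow_mul_exp {a r : ℂ} (ha : 0 < a.re) (hr : 0 < r.re) :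
    HasDerivAt (fun r : ℂ => ∫ t in Ioi (0 : ℝ), (t : ℂ) ^ (a - 1) * Complex.exp (-(r * t)))
      (∫ t in Ioi (0 : ℝ), (t : ℂ) ^ (a - 1) * (Complex.exp (-(r * t)) * -t)) r := by
  have hs : {z : ℂ | r.re / 2 < z.re} ∈ 𝓝 r :=
    (isOpen_lt continuous_const Complex.continuous_re).mem_nhds (by simp; linarith)
  refine (hasDerivAt_integral_of_dominated_loc_of_deriv_le
    (F' := fun (r : ℂ) (t : ℝ) => (t : ℂ) ^ (a - 1) * (Complex.exp (-(r * t)) * -t))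
    -- Halving the rate gives a bound uniform near `r`; the factor `t` from the derivative raises
    -- the Gamma parameter by one.
    (bound := fun t => t ^ (a.re + 1 - 1) * Real.exp (-(r.re / 2 * t))) hs
    (.of_forall fun z => aestronglyMeasurable_cpow_mul_exp a z)
    (integrableOn_cpow_mul_exp_neg_mul ha hr) ?_ ?_
    (integrableOn_rpow_mul_exp_neg_mul (by linarith) (by linarith)) ?_).2
  · exact (by fun_prop : Measurable
      (fun t : ℝ => (t : ℂ) ^ (a - 1) * (Complex.exp (-(r * t)) * -t))).aestronglyMeasurable
  · filter_upwards [ae_restrict_mem measurableSet_Ioi] with t (ht : 0 < t) z hz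
    rw [← mul_assoc, norm_mul, norm_cpow_mul_exp_neg_mul a z ht, norm_neg, Complex.norm_real,
      Real.norm_of_nonneg ht.le, mul_right_comm, ← Real.rpow_add_one ht.ne',
      sub_add_cancel, add_sub_cancel_right]
    gcongr
  · refine .of_forall fun t z _ => ?_
    have : HasDerivAt (fun z : ℂ => -(z * t)) (-t : ℂ) z := by
      simpa using ((hasDerivAt_id' z).mul_const (t : ℂ)).fun_neg
    exact this.cexp.const_mul _

/-- Euler's integral for the Gamma function with a complex rate of positive real part. -/
theorem integral_cpow_mul_exp_neg_mul_Ioi_of_re_pos {a r : ℂ} (ha : 0 < a.re) (hr : 0 < r.re) :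
    ∫ t in Ioi (0 : ℝ), (t : ℂ) ^ (a - 1) * Complex.exp (-(r * t)) =
      r ^ (-a) * Complex.Gamma a := by
  have ho : IsOpen {z : ℂ | 0 < z.re} := isOpen_lt continuous_const Complex.continuous_re
  have hF : DifferentiableOn ℂ (fun r : ℂ => ∫ t in Ioi (0 : ℝ), (t : ℂ) ^ (a - 1) *
      Complex.exp (-(r * t))) {z : ℂ | 0 < z.re} := fun z hz =>
    (hasDerivAt_integral_cpow_mul_exp ha hz).differentiableAt.differentiableWithinAt
  have hG : DifferentiableOn ℂ (fun r : ℂ => r ^ (-a) * Complex.Gamma a) {z : ℂ | 0 < z.re} :=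
    fun z hz => ((differentiableAt_id.cpow_const (Or.inl hz)).mul_const _).differentiableWithinAt
  refine (hF.analyticOnNhd ho).eqOn_of_preconnected_of_frequently_eq (hG.analyticOnNhd ho)
    (convex_halfSpace_re_gt 0).isPreconnected (z₀ := 1) (by simp) ?_ hr
  -- The formula is known for positive real rates; a real sequence tending to `1` suffices for the
  -- identity theorem.
  have hlim : Tendsto (fun n : ℕ => (((1 + 1 / ((n : ℝ) + 1) : ℝ)) : ℂ)) atTop (𝓝[≠] 1) := by
    refine tendsto_nhdsWithin_iff.2 ⟨?_, .of_forall fun n => ?_⟩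
    · have h := tendsto_one_div_add_atTop_nhds_zero_nat (𝕜 := ℝ)
      have := (Complex.continuous_ofReal.tendsto _).comp (h.const_add 1)
      simpa [Function.comp_def] using this
    · have : (1 : ℝ) / ((n : ℝ) + 1) ≠ 0 := by positivity
      rwa [mem_compl_iff, mem_singleton_iff, Complex.ofReal_eq_one, add_eq_left]
  refine hlim.frequently (Frequently.of_forall fun n => ?_)
  have hpos : (0 : ℝ) < 1 + 1 / ((n : ℝ) + 1) := by positivity
  rw [Complex.integral_cpow_mul_exp_neg_mul_Ioi ha hpos, one_div, Complex.inv_cpow,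
    Complex.cpow_neg]
  rw [Complex.arg_ofReal_of_nonneg hpos.le]
  exact Real.pi_pos.ne

/-! ### Growth of powers along a vertical line. -/

lemma sub_ofReal_mul_I_re (v : ℂ) (x : ℝ) : (v - x * Complex.I).re = v.re := by simp

lemma sub_ofReal_mul_I_ne_zero {v : ℂ} (hv : 0 < v.re) (x : ℝ) : v - x * Complex.I ≠ 0 := by
  intro h
  have := sub_ofReal_mul_I_re v x
  rw [h] at this
  simp at this
  linarith

lemma norm_cpow_le_exp {z : ℂ} (hz : z ≠ 0) (w : ℂ) :
    ‖z ^ w‖ ≤ Real.exp (‖w‖ * ‖Complex.log z‖) := by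
  rw [Complex.cpow_def_of_ne_zero hz, Complex.norm_exp, Real.exp_le_exp, mul_comm ‖w‖, ← norm_mul]
  exact Complex.re_le_norm _

lemma exp_norm_log_le {z : ℂ} (hz : z ≠ 0) :
    Real.exp ‖Complex.log z‖ ≤ Real.exp Real.pi * (‖z‖ + ‖z‖⁻¹) := by
  have hz' : 0 < ‖z‖ := norm_pos_iff.2 hz
  have h1 : ‖Complex.log z‖ ≤ |Real.log ‖z‖| + Real.pi := by
    refine (Complex.norm_le_abs_re_add_abs_im _).trans ?_
    rw [Complex.log_re, Complex.log_im]
    gcongr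
    exact Complex.abs_arg_le_pi z
  have h2 : Real.exp |Real.log ‖z‖| ≤ ‖z‖ + ‖z‖⁻¹ := by
    rcases abs_cases (Real.log ‖z‖) with ⟨h, _⟩ | ⟨h, _⟩ <;> rw [h]
    · rw [Real.exp_log hz']
      linarith [inv_pos.2 hz']
    · rw [Real.exp_neg, Real.exp_log hz']
      linarith
  calc Real.exp ‖Complex.log z‖ ≤ Real.exp (|Real.log ‖z‖| + Real.pi) := by gcongr
    _ = Real.exp Real.pi * Real.exp |Real.log ‖z‖| := by rw [Real.exp_add, mul_comm]
    _ ≤ _ := by gcongr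

/-- Since `|log z| ≤ |ln |z|| + π` and `|z|` is bounded below on the line, the left side grows at
most polynomially in `x`. Any exponential majorant would do; the exponents `±x/2` lie within the
range where the transforms used below converge. -/
lemma exists_exp_norm_log_sub_le {v : ℂ} (hv : 0 < v.re) (R : ℝ) :
    ∃ C : ℝ, 0 ≤ C ∧ ∀ x : ℝ, Real.exp (R * ‖Complex.log (v - x * Complex.I)‖) ≤
      C * (Real.exp (x / 2) + Real.exp (-(x / 2))) := by
  obtain ⟨N, hN⟩ := exists_nat_ge R
  set A : ℝ := ‖v‖ + v.re⁻¹ with hA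
  have hA0 : 0 ≤ A := by positivity
  refine ⟨Real.exp Real.pi ^ N * (2 ^ N * (N.factorial * Real.exp (A / 2))), by positivity,
    fun x => ?_⟩
  set z := v - x * Complex.I with hz
  have hz0 : z ≠ 0 := sub_ofReal_mul_I_ne_zero hv x
  have hre : v.re ≤ ‖z‖ := by
    rw [← sub_ofReal_mul_I_re v x]
    exact Complex.re_le_norm _
  have hnorm : ‖z‖ + ‖z‖⁻¹ ≤ A + |x| := by
    have h1 : ‖z‖ ≤ ‖v‖ + |x| := (norm_sub_le _ _).trans (by simp)
    have h2 : ‖z‖⁻¹ ≤ v.re⁻¹ := inv_anti₀ hv hre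
    linarith
  have hpow : (A + |x|) ^ N ≤ 2 ^ N * (N.factorial * (Real.exp (A / 2) * Real.exp (|x| / 2))) := by
    have h := Real.pow_div_factorial_le_exp (x := (A + |x|) / 2) (by positivity) N
    rw [div_le_iff₀ (by positivity), add_div, Real.exp_add, ← add_div, div_pow,
      div_le_iff₀ (by positivity)] at h
    linarith
  have habs : Real.exp (|x| / 2) ≤ Real.exp (x / 2) + Real.exp (-(x / 2)) := by
    rcases abs_cases x with ⟨h, _⟩ | ⟨h, _⟩ <;> rw [h]
    · linarith [Real.exp_pos (-(x / 2))]
    · rw [neg_div]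
      linarith [Real.exp_pos (x / 2)]
  calc Real.exp (R * ‖Complex.log z‖) ≤ Real.exp (N * ‖Complex.log z‖) := by gcongr
    _ = Real.exp ‖Complex.log z‖ ^ N := by rw [Real.exp_nat_mul]
    _ ≤ (Real.exp Real.pi * (A + |x|)) ^ N := by
      gcongr
      exact (exp_norm_log_le hz0).trans (by gcongr)
    _ = Real.exp Real.pi ^ N * (A + |x|) ^ N := mul_pow _ _ _
    _ ≤ Real.exp Real.pi ^ N *
        (2 ^ N * (N.factorial * (Real.exp (A / 2) * Real.exp (|x| / 2)))) := by gcongr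
    _ ≤ Real.exp Real.pi ^ N * (2 ^ N * (N.factorial * (Real.exp (A / 2) *
        (Real.exp (x / 2) + Real.exp (-(x / 2)))))) := by gcongr
    _ = _ := by ring

/-! ### Integrals of complex powers against a weight. -/

section WeightedPower

variable {Ω : Type*} [MeasurableSpace Ω] {μ : Measure Ω} {c : Ω → ℂ} {ℓ : Ω → ℝ}

lemma integrable_weight_mul_cpow (hc : Measurable c) (hℓ : Measurable ℓ)
    (h : Integrable (fun y => ‖c y‖ * (Real.exp (ℓ y / 2) + Real.exp (-(ℓ y / 2)))) μ)
    {v : ℂ} (hv : 0 < v.re) (w : ℂ) :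
    Integrable (fun y => c y * (v - ℓ y * Complex.I) ^ w) μ := by
  obtain ⟨C, -, hC⟩ := exists_exp_norm_log_sub_le hv ‖w‖
  refine (h.const_mul C).mono' (by fun_prop : Measurable _).aestronglyMeasurable
    (.of_forall fun y => ?_)
  rw [norm_mul]
  calc _ ≤ ‖c y‖ * (C * (Real.exp (ℓ y / 2) + Real.exp (-(ℓ y / 2)))) := by
        gcongr
        exact (norm_cpow_le_exp (sub_ofReal_mul_I_ne_zero hv _) w).trans (hC _)
    _ = _ := by ring

/-- An integral of complex powers of a function with values on a vertical line in the right
half-plane is an entire function of the exponent. -/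
theorem differentiable_integral_weight_mul_cpow (hc : Measurable c) (hℓ : Measurable ℓ)
    (h : Integrable (fun y => ‖c y‖ * (Real.exp (ℓ y / 2) + Real.exp (-(ℓ y / 2)))) μ)
    {v : ℂ} (hv : 0 < v.re) :
    Differentiable ℂ (fun w : ℂ => ∫ y, c y * (v - ℓ y * Complex.I) ^ w ∂μ) := by
  intro w
  -- One unit covers the ball of radius `1` around `w`; the other absorbs the logarithm produced by
  -- differentiation, via `x ≤ exp x`.
  obtain ⟨C, -, hC⟩ := exists_exp_norm_log_sub_le hv (‖w‖ + 1 + 1)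
  refine (hasDerivAt_integral_of_dominated_loc_of_deriv_le (Metric.ball_mem_nhds w one_pos)
    (F' := fun w y => c y * ((v - ℓ y * Complex.I) ^ w * Complex.log (v - ℓ y * Complex.I)))
    (bound := fun y => C * (‖c y‖ * (Real.exp (ℓ y / 2) + Real.exp (-(ℓ y / 2)))))
    (.of_forall fun z => (by fun_prop : Measurable _).aestronglyMeasurable)
    (integrable_weight_mul_cpow hc hℓ h hv w)
    (by fun_prop : Measurable _).aestronglyMeasurable
    (.of_forall fun y z hz => ?_) (h.const_mul C)
    (.of_forall fun y z _ => ?_)).2.differentiableAt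
  · have hz' : ‖z‖ ≤ ‖w‖ + 1 := by
      have h1 : ‖z - w‖ < 1 := by simpa [dist_eq_norm] using hz
      have h2 : ‖z‖ ≤ ‖w‖ + ‖z - w‖ := by simpa using norm_add_le w (z - w)
      linarith
    set b := v - ℓ y * Complex.I with hb
    rw [norm_mul, norm_mul]
    calc _ ≤ ‖c y‖ * (Real.exp ((‖w‖ + 1) * ‖Complex.log b‖) * Real.exp ‖Complex.log b‖) := by
          gcongr
          · exact (norm_cpow_le_exp (sub_ofReal_mul_I_ne_zero hv _) z).trans (by gcongr)
          · linarith [Real.add_one_le_exp ‖Complex.log b‖]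
      _ = ‖c y‖ * Real.exp ((‖w‖ + 1 + 1) * ‖Complex.log b‖) := by
          rw [← Real.exp_add]
          ring_nf
      _ ≤ ‖c y‖ * (C * (Real.exp (ℓ y / 2) + Real.exp (-(ℓ y / 2)))) := by
          gcongr
          exact hC _
      _ = _ := by ring
  · refine HasDerivAt.const_mul _ ?_
    simpa using (hasDerivAt_id' z).const_cpow (c := v - ℓ y * Complex.I)
      (Or.inl (sub_ofReal_mul_I_ne_zero hv _))

/-- The Laplace representation of an integral of complex powers. -/
theorem Gamma_mul_integral_weight_mul_cpow [SFinite μ] (hc : Integrable c μ) (hℓ : Measurable ℓ)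
    {v : ℂ} (hv : 0 < v.re) {σ : ℂ} (hσ : 0 < σ.re) :
    Complex.Gamma σ * ∫ y, c y * (v - ℓ y * Complex.I) ^ (-σ) ∂μ =
      ∫ t in Ioi (0 : ℝ), (t : ℂ) ^ (σ - 1) * Complex.exp (-(v * t)) *
        ∫ y, c y * Complex.exp (t * ℓ y * Complex.I) ∂μ := by
  -- Fubini applies because `exp (i ℓ t)` has modulus one, leaving a product of integrable
  -- functions.
  have hint : Integrable (fun p : Ω × ℝ => c p.1 * ((p.2 : ℂ) ^ (σ - 1) *
      Complex.exp (-((v - ℓ p.1 * Complex.I) * p.2)))) (μ.prod (volume.restrict (Ioi 0))) := by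
    have h1 := hc.mul_prod (integrableOn_cpow_mul_exp_neg_mul hσ hv)
    have h2 : Measurable (fun p : Ω × ℝ => Complex.exp (ℓ p.1 * Complex.I * p.2)) := by fun_prop
    refine (h1.mul_bdd (c := 1) h2.aestronglyMeasurable (.of_forall fun p => ?_)).congr
      (.of_forall fun p => ?_)
    · rw [Complex.norm_exp]
      simp
    · simp only
      rw [mul_assoc, mul_assoc, ← Complex.exp_add]
      ring_nf
  calc _ = ∫ y, (∫ t in Ioi (0 : ℝ), c y * ((t : ℂ) ^ (σ - 1) *
        Complex.exp (-((v - ℓ y * Complex.I) * t)))) ∂μ := by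
        rw [← integral_const_mul]
        refine integral_congr_ae (.of_forall fun y => ?_)
        simp only
        rw [integral_const_mul, integral_cpow_mul_exp_neg_mul_Ioi_of_re_pos hσ (by simpa using hv)]
        ring
    _ = ∫ t in Ioi (0 : ℝ), (∫ y, c y * ((t : ℂ) ^ (σ - 1) *
        Complex.exp (-((v - ℓ y * Complex.I) * t))) ∂μ) := integral_integral_swap hint
    _ = _ := by
        refine integral_congr_ae (.of_forall fun t => ?_)
        simp only
        rw [← integral_const_mul]
        refine integral_congr_ae (.of_forall fun y => ?_)
        simp only
        rw [show -((v - ℓ y * Complex.I) * t) = -(v * t) + t * ℓ y * Complex.I by ring,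
          Complex.exp_add]
        ring

end WeightedPower

/-! ### From characteristic functions to Dirichlet series. -/

lemma summable_one_div_add_nat_mul_rpow {a β p : ℝ} (ha : 0 < a) (hβ : 0 < β) (hp : 1 < p) :
    Summable (fun n : ℕ => (1 / (a + n * β)) ^ p) := by
  have h := ((Real.summable_one_div_nat_add_rpow (a / β) p).2 hp).mul_left ((1 / β) ^ p)
  refine h.congr fun n => ?_
  have h0 : 0 < (n : ℝ) + a / β := by positivity
  rw [abs_of_pos h0, ← Real.one_rpow p, ← Real.div_rpow zero_le_one h0.le,
    Real.one_rpow, ← Real.mul_rpow (by positivity) (by positivity)]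
  congr 1
  field_simp
  ring

/-- Termwise integration of a geometric-exponential series against `t ^ (s - 1)`. -/
theorem integral_cpow_mul_tsum_exp {b s ε : ℂ} {β : ℝ} (hb : 0 < b.re) (hβ : 0 < β)
    (hs : 1 < s.re) (hε : ‖ε‖ = 1) :
    ∫ t in Ioi (0 : ℝ), ∑' n : ℕ, ε ^ n * ((t : ℂ) ^ (s - 1) *
        Complex.exp (-((b + n * β) * t))) =
      Complex.Gamma s * ∑' n : ℕ, ε ^ n * (b + n * β) ^ (-s) := by
  have hs0 : 0 < s.re := by linarith
  have hbn (n : ℕ) : 0 < (b + n * β).re := by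
    simp
    positivity
  have hbn' (n : ℕ) : (b + n * β).re = b.re + n * β := by simp
  have h := hasSum_integral_of_summable_integral_norm (μ := volume.restrict (Ioi (0 : ℝ)))
    (F := fun (n : ℕ) (t : ℝ) => ε ^ n * ((t : ℂ) ^ (s - 1) * Complex.exp (-((b + n * β) * t))))
    (fun n => (integrableOn_cpow_mul_exp_neg_mul hs0 (hbn n)).const_mul _) ?_
  · rw [← h.tsum_eq, ← tsum_mul_left]
    congr 1
    ext n
    rw [integral_const_mul, integral_cpow_mul_exp_neg_mul_Ioi_of_re_pos hs0 (hbn n)]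
    ring
  · refine ((summable_one_div_add_nat_mul_rpow hb hβ hs).mul_right (Real.Gamma s.re)).congr
      fun n => ?_
    rw [← hbn', ← Real.integral_rpow_mul_exp_neg_mul_Ioi hs0 (hbn n)]
    refine setIntegral_congr_fun measurableSet_Ioi fun t ht => ?_
    rw [norm_mul, norm_pow, hε, one_pow, one_mul, norm_cpow_mul_exp_neg_mul _ _ ht]

/-- If the characteristic function of a weight is `ξ` times a geometric series of decaying
exponentials, then its integrals of complex powers are shifted Dirichlet series. -/
theorem integral_weight_mul_cpow_eq_tsum {Ω : Type*} [MeasurableSpace Ω] {μ : Measure Ω} [SFinite μ]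
    {c : Ω → ℂ} {ℓ : Ω → ℝ} (hc : Integrable c μ) (hℓ : Measurable ℓ) {v s κ ε : ℂ} {α β : ℝ}
    (hv : 0 < v.re) (hs : 1 < s.re) (hα : 0 < α) (hβ : 0 < β) (hε : ‖ε‖ = 1)
    (hΦ : ∀ t : ℝ, 0 < t → ∫ y, c y * Complex.exp (t * ℓ y * Complex.I) ∂μ =
      t * (κ * (Complex.exp (-(α * t)) * (1 - ε * Complex.exp (-(β * t)))⁻¹))) :
    ∫ y, c y * (v - ℓ y * Complex.I) ^ (1 - s) ∂μ =
      (s - 1) * (κ * ∑' n : ℕ, ε ^ n * (v + α + n * β) ^ (-s)) := by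
  have hs1 : 0 < (s - 1).re := by simpa using hs
  have hs1' : s - 1 ≠ 0 := fun h => by simp [h] at hs1
  have hL := Gamma_mul_integral_weight_mul_cpow hc hℓ hv hs1
  have hR := integral_cpow_mul_tsum_exp (b := v + α) (s := s) (ε := ε) (β := β)
    (by simp; positivity) hβ hs hε
  -- The factor `t` in `hΦ` turns `t ^ (s - 2)` into `t ^ (s - 1)`, so `Γ(s)` meets `Γ(s - 1)`;
  -- their ratio is the prefactor `s - 1`.
  have hΓ : Complex.Gamma s = (s - 1) * Complex.Gamma (s - 1) := by
    rw [← Complex.Gamma_add_one _ hs1', sub_add_cancel]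
  have key : Complex.Gamma (s - 1) * ∫ y, c y * (v - ℓ y * Complex.I) ^ (-(s - 1)) ∂μ =
      κ * (Complex.Gamma s * ∑' n : ℕ, ε ^ n * (v + α + n * β) ^ (-s)) := by
    rw [hL, ← hR, ← integral_const_mul]
    refine setIntegral_congr_fun measurableSet_Ioi fun t (ht : 0 < t) => ?_
    have ht0 : (t : ℂ) ≠ 0 := Complex.ofReal_ne_zero.2 ht.ne'
    have hlt : ‖ε * Complex.exp (-(β * t))‖ < 1 := by
      rw [norm_mul, hε, one_mul, Complex.norm_exp, Real.exp_lt_one_iff]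
      simp
      positivity
    rw [hΦ t ht, ← tsum_geometric_of_norm_lt_one hlt]
    have hterm (n : ℕ) : ε ^ n * ((t : ℂ) ^ (s - 1) *
        Complex.exp (-((v + α + n * β) * t))) =
        ((t : ℂ) ^ (s - 1) * Complex.exp (-(v * t)) * Complex.exp (-(α * t))) *
          (ε * Complex.exp (-(β * t))) ^ n := by
      rw [mul_pow, ← Complex.exp_nat_mul, show -((v + α + n * β) * (t : ℂ)) =
        -(v * t) + -(α * t) + n * -(β * t) by ring, Complex.exp_add, Complex.exp_add]
      ring
    simp_rw [hterm]
    rw [tsum_mul_left, Complex.cpow_sub _ _ ht0, Complex.cpow_one]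
    field_simp
  rw [neg_sub, hΓ] at key
  refine mul_left_cancel₀ (Complex.Gamma_ne_zero_of_re_pos hs1) (key.trans ?_)
  ring

/-! ### Beta integrals and the logistic transform. -/

lemma integrableOn_beta {u v : ℂ} (hu : 0 < u.re) (hv : 0 < v.re) :
    IntegrableOn (fun x : ℝ => (x : ℂ) ^ (u - 1) * (1 - (x : ℂ)) ^ (v - 1)) (Ioo 0 1) :=
  ((intervalIntegrable_iff_integrableOn_Ioo_of_le zero_le_one).1
    (Complex.betaIntegral_convergent hu hv))

lemma integral_Ioo_beta {u v : ℂ} (hu : 0 < u.re) (hv : 0 < v.re) :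
    ∫ x in Ioo (0 : ℝ) 1, (x : ℂ) ^ (u - 1) * (1 - (x : ℂ)) ^ (v - 1) =
      Complex.Gamma u * Complex.Gamma v / Complex.Gamma (u + v) := by
  rw [← Complex.betaIntegral_eq_Gamma_mul_div u v hu hv, Complex.betaIntegral,
    intervalIntegral.integral_of_le zero_le_one, integral_Ioc_eq_integral_Ioo]

lemma cpow_ofReal_eq_exp {x : ℝ} (hx : 0 < x) (w : ℂ) :
    (x : ℂ) ^ w = Complex.exp (w * Real.log x) := by
  rw [Complex.cpow_def_of_ne_zero (Complex.ofReal_ne_zero.2 hx.ne'), ← Complex.ofReal_log hx.le,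
    mul_comm]

lemma exp_mul_logit {x : ℝ} (hx : x ∈ Ioo (0 : ℝ) 1) (w : ℂ) :
    Complex.exp (w * Real.log (x / (1 - x))) =
      (x : ℂ) ^ (1 + w - 1) * (1 - (x : ℂ)) ^ (1 - w - 1) := by
  have h1 : 0 < 1 - x := sub_pos.2 hx.2
  rw [← Complex.ofReal_one, ← Complex.ofReal_sub, cpow_ofReal_eq_exp hx.1, cpow_ofReal_eq_exp h1,
    ← Complex.exp_add, Real.log_div hx.1.ne' h1.ne']
  push_cast
  ring_nf

lemma integrableOn_exp_mul_logit {w : ℂ} (h1 : -1 < w.re) (h2 : w.re < 1) :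
    IntegrableOn (fun x : ℝ => Complex.exp (w * Real.log (x / (1 - x)))) (Ioo 0 1) :=
  (integrableOn_beta (u := 1 + w) (v := 1 - w) (by simp; linarith) (by simpa using h2)).congr_fun
    (fun _ hx => (exp_mul_logit hx w).symm) measurableSet_Ioo

/-- This is `B(1 + w, 1 - w) = w Γ(w) Γ(1 - w)`, evaluated by reflection. -/
lemma integral_exp_mul_logit {w : ℂ} (h1 : -1 < w.re) (h2 : w.re < 1) (h0 : w ≠ 0) :
    ∫ x in Ioo (0 : ℝ) 1, Complex.exp (w * Real.log (x / (1 - x))) =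
      Real.pi * w / Complex.sin (Real.pi * w) := by
  rw [setIntegral_congr_fun measurableSet_Ioo fun x hx => exp_mul_logit hx w,
    integral_Ioo_beta (by simp; linarith) (by simpa using h2),
    show 1 + w + (1 - w) = 2 by ring, Complex.Gamma_ofNat_eq_factorial, add_comm 1 w,
    Complex.Gamma_add_one w h0, mul_assoc, Complex.Gamma_mul_Gamma_one_sub]
  simp
  ring

/-! ### The transform of `cos 2y` against powers of `tan y`. -/

lemma sin_cos_pos_of_mem {y : ℝ} (hy : y ∈ Ioo 0 (Real.pi / 2)) :
    0 < Real.sin y ∧ 0 < Real.cos y :=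
  ⟨Real.sin_pos_of_pos_of_lt_pi hy.1 (by linarith [hy.2, Real.pi_pos]),
    Real.cos_pos_of_mem_Ioo ⟨by linarith [hy.1, Real.pi_pos], hy.2⟩⟩

lemma image_sin_sq_Ioo : (fun y : ℝ => Real.sin y ^ 2) '' Ioo 0 (Real.pi / 2) = Ioo 0 1 := by
  ext x
  constructor
  · rintro ⟨y, hy, rfl⟩
    obtain ⟨h1, h2⟩ := sin_cos_pos_of_mem hy
    exact ⟨by positivity, by nlinarith [Real.sin_sq_add_cos_sq y]⟩
  · rintro ⟨h0, h1⟩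
    have hs0 : 0 < √x := Real.sqrt_pos.2 h0
    have hs1 : √x < 1 := by rwa [Real.sqrt_lt' one_pos, one_pow]
    refine ⟨Real.arcsin √x, ⟨Real.arcsin_pos.2 hs0, ?_⟩, ?_⟩
    · exact Real.arcsin_lt_pi_div_two.2 hs1
    · simp only
      rw [Real.sin_arcsin (by linarith) hs1.le, Real.sq_sqrt h0.le]

lemma injOn_sin_sq : InjOn (fun y : ℝ => Real.sin y ^ 2) (Ioo 0 (Real.pi / 2)) := by
  intro y hy z hz h
  have := (pow_left_inj₀ (sin_cos_pos_of_mem hy).1.le (sin_cos_pos_of_mem hz).1.le two_ne_zero).1 h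
  exact Real.injOn_sin ⟨by linarith [hy.1, Real.pi_pos], hy.2.le⟩
    ⟨by linarith [hz.1, Real.pi_pos], hz.2.le⟩ this

lemma hasDerivAt_sin_sq (y : ℝ) :
    HasDerivAt (fun y : ℝ => Real.sin y ^ 2) (2 * Real.sin y * Real.cos y) y := by
  simpa using (Real.hasDerivAt_sin y).fun_pow 2

/-- The Beta integrand under the substitution `x = sin² y`, with the Jacobian absorbed into the
exponents. -/
lemma abs_deriv_smul_beta {y : ℝ} (hy : y ∈ Ioo 0 (Real.pi / 2)) (u v : ℂ) :
    |2 * Real.sin y * Real.cos y| • (((Real.sin y ^ 2 : ℝ) : ℂ) ^ (u - 1) *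
      (1 - ((Real.sin y ^ 2 : ℝ) : ℂ)) ^ (v - 1)) =
    2 * Complex.exp ((2 * u - 1) * Real.log (Real.sin y) +
      (2 * v - 1) * Real.log (Real.cos y)) := by
  obtain ⟨hs, hc⟩ := sin_cos_pos_of_mem hy
  rw [abs_of_pos (by positivity), ← Complex.ofReal_one, ← Complex.ofReal_sub,
    ← Real.cos_sq', cpow_ofReal_eq_exp (by positivity), cpow_ofReal_eq_exp (by positivity),
    Real.log_pow, Real.log_pow, Complex.real_smul]
  have h (x : ℝ) (hx : 0 < x) : (x : ℂ) = Complex.exp (Real.log x) := by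
    rw [← Complex.ofReal_exp, Real.exp_log hx]
  rw [Complex.ofReal_mul, Complex.ofReal_mul, h _ hs, h _ hc]
  simp only [Complex.ofReal_ofNat, mul_assoc, ← Complex.exp_add]
  push_cast
  ring_nf

lemma integrableOn_exp_log_sin_cos {u v : ℂ} (hu : 0 < u.re) (hv : 0 < v.re) :
    IntegrableOn (fun y : ℝ => 2 * Complex.exp ((2 * u - 1) * Real.log (Real.sin y) +
      (2 * v - 1) * Real.log (Real.cos y))) (Ioo 0 (Real.pi / 2)) := by
  have h := integrableOn_beta hu hv
  rw [← image_sin_sq_Ioo, integrableOn_image_iff_integrableOn_abs_deriv_smul measurableSet_Ioo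
    (fun y _ => (hasDerivAt_sin_sq y).hasDerivWithinAt) injOn_sin_sq] at h
  exact h.congr_fun (fun y hy => abs_deriv_smul_beta hy u v) measurableSet_Ioo

lemma integral_exp_log_sin_cos {u v : ℂ} (hu : 0 < u.re) (hv : 0 < v.re) :
    ∫ y in Ioo 0 (Real.pi / 2), 2 * Complex.exp ((2 * u - 1) * Real.log (Real.sin y) +
      (2 * v - 1) * Real.log (Real.cos y)) =
      Complex.Gamma u * Complex.Gamma v / Complex.Gamma (u + v) := by
  rw [← integral_Ioo_beta hu hv, ← image_sin_sq_Ioo,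
    integral_image_eq_integral_abs_deriv_smul measurableSet_Ioo
    (fun y _ => (hasDerivAt_sin_sq y).hasDerivWithinAt) injOn_sin_sq]
  exact (setIntegral_congr_fun measurableSet_Ioo fun y hy => abs_deriv_smul_beta hy u v).symm

/-- Splitting `cos 2y = cos² y - sin² y` gives two Beta integrands. -/
lemma cos_two_mul_mul_exp_log_tan {y : ℝ} (hy : y ∈ Ioo 0 (Real.pi / 2)) (w : ℂ) :
    (Real.cos (2 * y) : ℂ) * Complex.exp (w * Real.log (Real.tan y)) =
      1 / 2 * (2 * Complex.exp ((2 * ((1 + w) / 2) - 1) * Real.log (Real.sin y) +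
        (2 * ((3 - w) / 2) - 1) * Real.log (Real.cos y))) -
      1 / 2 * (2 * Complex.exp ((2 * ((3 + w) / 2) - 1) * Real.log (Real.sin y) +
        (2 * ((1 - w) / 2) - 1) * Real.log (Real.cos y))) := by
  obtain ⟨hs, hc⟩ := sin_cos_pos_of_mem hy
  have h (x : ℝ) (hx : 0 < x) : ((x ^ 2 : ℝ) : ℂ) = Complex.exp (2 * Real.log x) := by
    rw [← Real.exp_log (pow_pos hx 2), Real.log_pow]
    push_cast
    rfl
  rw [Real.cos_two_mul', Complex.ofReal_sub, h _ hs, h _ hc, sub_mul, ← Complex.exp_add,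
    ← Complex.exp_add, Real.tan_eq_sin_div_cos, Real.log_div hs.ne' hc.ne']
  push_cast
  ring_nf

lemma integrableOn_cos_two_mul_mul_exp_log_tan {w : ℂ} (h1 : -1 < w.re) (h2 : w.re < 1) :
    IntegrableOn (fun y : ℝ => (Real.cos (2 * y) : ℂ) * Complex.exp (w * Real.log (Real.tan y)))
      (Ioo 0 (Real.pi / 2)) := by
  have h := ((integrableOn_exp_log_sin_cos (u := (1 + w) / 2) (v := (3 - w) / 2)
    (by simp; linarith) (by simp; linarith)).const_mul (1 / 2)).sub
    ((integrableOn_exp_log_sin_cos (u := (3 + w) / 2) (v := (1 - w) / 2)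
    (by simp; linarith) (by simp; linarith)).const_mul (1 / 2))
  exact IntegrableOn.congr_fun h (fun _ hy => (cos_two_mul_mul_exp_log_tan hy w).symm)
    measurableSet_Ioo

/-- Both Beta values have denominator `Γ(2) = 1` and share the factor `Γ((1+w)/2) Γ((1-w)/2) = π /
cos (πw/2)`; the remaining coefficients `(1-w)/2` and `(1+w)/2` differ by `-w`. -/
lemma integral_cos_two_mul_mul_exp_log_tan {w : ℂ} (h1 : -1 < w.re) (h2 : w.re < 1) :
    ∫ y in Ioo 0 (Real.pi / 2), (Real.cos (2 * y) : ℂ) * Complex.exp (w * Real.log (Real.tan y)) =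
      -(w / 2) * (Real.pi / Complex.cos (Real.pi * w / 2)) := by
  have ha : 0 < ((1 + w) / 2).re := by simp; linarith
  have hb : 0 < ((1 - w) / 2).re := by simp; linarith
  have ha' : 0 < ((3 + w) / 2).re := by simp; linarith
  have hb' : 0 < ((3 - w) / 2).re := by simp; linarith
  have ha0 : (1 + w) / 2 ≠ 0 := fun h => by simp [h] at ha
  have hb0 : (1 - w) / 2 ≠ 0 := fun h => by simp [h] at hb
  rw [setIntegral_congr_fun measurableSet_Ioo fun y hy => cos_two_mul_mul_exp_log_tan hy w,
    integral_sub ((integrableOn_exp_log_sin_cos ha hb').const_mul _)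
      ((integrableOn_exp_log_sin_cos ha' hb).const_mul _),
    integral_const_mul (1 / 2 : ℂ), integral_const_mul (1 / 2 : ℂ), integral_exp_log_sin_cos ha hb',
    integral_exp_log_sin_cos ha' hb, show (1 + w) / 2 + (3 - w) / 2 = 2 by ring,
    show (3 + w) / 2 + (1 - w) / 2 = 2 by ring, show (3 + w) / 2 = (1 + w) / 2 + 1 by ring,
    show (3 - w) / 2 = (1 - w) / 2 + 1 by ring, Complex.Gamma_add_one _ ha0,
    Complex.Gamma_add_one _ hb0, Complex.Gamma_ofNat_eq_factorial]
  have h := Complex.Gamma_mul_Gamma_one_sub ((1 + w) / 2)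
  rw [show 1 - (1 + w) / 2 = (1 - w) / 2 by ring, show Real.pi * ((1 + w) / 2) =
    Real.pi * w / 2 + Real.pi / 2 by ring, Complex.sin_add_pi_div_two] at h
  rw [← h]
  simp
  ring

/-! ### The Hurwitz series and its continuation. -/

lemma summable_cpow_add_nat {u s : ℂ} (hu : 0 < u.re) (hs : 1 < s.re) :
    Summable (fun n : ℕ => 1 / ((n : ℂ) + u) ^ s) := by
  refine Summable.of_norm_bounded
    ((summable_one_div_add_nat_mul_rpow hu one_pos hs).mul_left (Real.exp (Real.pi * |s.im|)))
    fun n => ?_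
  have hre : ((n : ℂ) + u).re = u.re + n * 1 := by simp [add_comm]
  have hpos : 0 < ((n : ℂ) + u).re := by rw [hre]; positivity
  rw [one_div, ← Complex.cpow_neg, ← hre, one_div, Real.inv_rpow hpos.le, ← Real.rpow_neg hpos.le]
  refine (Complex.norm_cpow_le _ _).trans ?_
  rw [div_eq_mul_inv, ← Real.exp_neg, mul_comm]
  gcongr ?_ * ?_
  · rw [Real.exp_le_exp]
    refine (le_abs_self _).trans ?_
    rw [abs_neg, abs_mul, Complex.neg_im, abs_neg]
    gcongr
    exact Complex.abs_arg_le_pi _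
  · rw [Complex.neg_re]
    exact Real.rpow_le_rpow_of_nonpos hpos (Complex.re_le_norm _) (by linarith)

lemma integrable_weight_logit : Integrable (fun x : ℝ => ‖(1 : ℂ)‖ *
    (Real.exp (Real.log (x / (1 - x)) / (2 * Real.pi) / 2) +
      Real.exp (-(Real.log (x / (1 - x)) / (2 * Real.pi) / 2)))) (volume.restrict (Ioo 0 1)) := by
  -- With `ℓ = logit / (2π)`, the exponents `±ℓ/2` are the logistic transform at `w = ±1/(4π)`,
  -- inside the strip `|Re w| < 1`.
  have hlt : (4 * Real.pi)⁻¹ < 1 := inv_lt_one_of_one_lt₀ (by linarith [Real.pi_gt_three])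
  have hpos : 0 < (4 * Real.pi)⁻¹ := by positivity
  have h1 := (integrableOn_exp_mul_logit (w := ((4 * Real.pi)⁻¹ : ℝ))
    (by rw [Complex.ofReal_re]; linarith) (by rwa [Complex.ofReal_re])).norm
  have h2 := (integrableOn_exp_mul_logit (w := (-(4 * Real.pi)⁻¹ : ℝ))
    (by rw [Complex.ofReal_re]; linarith) (by rw [Complex.ofReal_re]; linarith)).norm
  refine (h1.add h2).congr (.of_forall fun x => ?_)
  simp only [Pi.add_apply, ← Complex.ofReal_mul, Complex.norm_exp, Complex.ofReal_re, norm_one,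
    one_mul]
  congr 2 <;> (field_simp; ring)

/-- At `w = it/(2π)` the logistic transform is `(t/2) / sinh (t/2)`; the scaling by `2π` makes the
geometric ratio `e^{-t}`, hence unit steps in the series. -/
lemma integral_exp_logit {t : ℝ} (ht : 0 < t) :
    ∫ x in Ioo (0 : ℝ) 1, (1 : ℂ) *
        Complex.exp (t * (Real.log (x / (1 - x)) / (2 * Real.pi) : ℝ) * Complex.I) =
      t * (1 * (Complex.exp (-((1 / 2 : ℝ) * t)) *
        (1 - 1 * Complex.exp (-((1 : ℝ) * t)))⁻¹)) := by
  have hπ : (Real.pi : ℂ) ≠ 0 := Complex.ofReal_ne_zero.2 Real.pi_ne_zero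
  have ht0 : (t : ℂ) ≠ 0 := Complex.ofReal_ne_zero.2 ht.ne'
  set w : ℂ := t * Complex.I / (2 * Real.pi) with hw
  have hw0 : w ≠ 0 := div_ne_zero (mul_ne_zero ht0 Complex.I_ne_zero) (by simp)
  have hwre : w.re = 0 := by
    rw [hw, show (t : ℂ) * Complex.I / (2 * Real.pi) = ((t / (2 * Real.pi) : ℝ) : ℂ) * Complex.I by
      push_cast; ring, Complex.re_ofReal_mul, Complex.I_re, mul_zero]
  have h1 : ∀ x : ℝ, (1 : ℂ) *
      Complex.exp (t * (Real.log (x / (1 - x)) / (2 * Real.pi) : ℝ) * Complex.I) =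
      Complex.exp (w * Real.log (x / (1 - x))) := fun x => by
    rw [one_mul, hw]
    push_cast
    ring_nf
  simp_rw [h1]
  rw [integral_exp_mul_logit (by rw [hwre]; norm_num) (by rw [hwre]; norm_num) hw0,
    show Real.pi * w = (t / 2 : ℂ) * Complex.I by rw [hw]; field_simp, Complex.sin_mul_I,
    Complex.sinh]
  have he : Complex.exp (-(t : ℂ)) = Complex.exp (-(t / 2 : ℂ)) * Complex.exp (-(t / 2 : ℂ)) := by
    rw [← Complex.exp_add]
    ring_nf
  have hinv : Complex.exp (t / 2 : ℂ) * Complex.exp (-(t / 2 : ℂ)) = 1 := by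
    rw [← Complex.exp_add, add_neg_cancel, Complex.exp_zero]
  have hne : 1 - Complex.exp (-(t : ℂ)) ≠ 0 := by
    have : Real.exp (-t) < 1 := by simpa using ht
    have h : (1 - Real.exp (-t) : ℝ) ≠ 0 := by linarith
    exact_mod_cast Complex.ofReal_ne_zero.2 h
  have hne' : Complex.exp (t / 2 : ℂ) - Complex.exp (-(t / 2 : ℂ)) ≠ 0 := fun h => hne <| by
    rw [he, ← hinv, ← sub_mul, h, zero_mul]
  have harg : -((1 / 2 : ℝ) * t : ℂ) = -(t / 2 : ℂ) := by
    push_cast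
    ring
  rw [harg, Complex.ofReal_one, one_mul, one_mul, one_mul]
  field_simp
  rw [he]
  linear_combination -hinv

/-- Jensen's integral for the Hurwitz zeta function. -/
lemma integral_logit_cpow_eq_tsum {u s : ℂ} (hu : 1 / 2 < u.re) (hs : 1 < s.re) :
    ∫ x in Ioo (0 : ℝ) 1, (1 : ℂ) * ((u - 1 / 2) -
        (Real.log (x / (1 - x)) / (2 * Real.pi) : ℝ) * Complex.I) ^ (1 - s) =
      (s - 1) * ∑' n : ℕ, 1 / ((n : ℂ) + u) ^ s := by
  have hv : 0 < (u - 1 / 2).re := by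
    rw [Complex.sub_re]
    norm_num
    linarith
  rw [integral_weight_mul_cpow_eq_tsum (μ := volume.restrict (Ioo (0 : ℝ) 1))
    (ℓ := fun x => Real.log (x / (1 - x)) / (2 * Real.pi)) (α := 1 / 2) (β := 1) (ε := 1) (κ := 1)
    (integrable_const _) (by fun_prop) hv hs (by norm_num) one_pos (by simp)
    fun t ht => integral_exp_logit ht]
  congr 1
  rw [one_mul]
  refine tsum_congr fun n => ?_
  rw [one_pow, one_mul, Complex.cpow_neg, one_div]
  push_cast
  ring_nf

/-- The Hurwitz series with parameter in the right half-plane continues to `ℂ \ {1}`. -/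
theorem exists_isHurwitzContinuation {u : ℂ} (hu : 0 < u.re) :
    ∃ F : ℂ → ℂ, IsHurwitzContinuation u F := by
  have hu0 : u ≠ 0 := fun h => by simp [h] at hu
  have hv : 0 < (u + 1 - 1 / 2).re := by
    rw [Complex.sub_re, Complex.add_re]
    norm_num
    linarith
  -- Jensen's integral needs `Re u > 1/2`, so the `n = 0` term is split off and the integral taken
  -- at `u + 1`.
  refine ⟨fun s => 1 / u ^ s + (s - 1)⁻¹ * ∫ x in Ioo (0 : ℝ) 1, (1 : ℂ) * ((u + 1 - 1 / 2) -
    (Real.log (x / (1 - x)) / (2 * Real.pi) : ℝ) * Complex.I) ^ (1 - s), ?_, fun s hs => ?_⟩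
  · have hD := differentiable_integral_weight_mul_cpow (μ := volume.restrict (Ioo (0 : ℝ) 1))
      (c := fun _ => 1) (ℓ := fun x => Real.log (x / (1 - x)) / (2 * Real.pi)) measurable_const
      (by fun_prop) integrable_weight_logit hv
    have hD' := hD.comp (differentiable_id.const_sub (1 : ℂ))
    intro s hs
    have hs1 : s - 1 ≠ 0 := sub_ne_zero.2 hs
    refine DifferentiableAt.differentiableWithinAt (DifferentiableAt.add ?_
      (DifferentiableAt.mul ?_ (hD' s)))
    · exact (differentiableAt_const _).div (differentiableAt_id.const_cpow (Or.inl hu0))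
        (by simp [Complex.cpow_eq_zero_iff, hu0])
    · exact (differentiableAt_id.sub_const _).inv hs1
  · have hs1 : s - 1 ≠ 0 := fun h => by
      rw [sub_eq_zero.1 h] at hs
      simp at hs
    have hu1 : 1 / 2 < (u + 1).re := by
      rw [Complex.add_re, Complex.one_re]
      linarith
    simp only
    rw [integral_logit_cpow_eq_tsum hu1 hs, inv_mul_cancel_left₀ hs1,
      (summable_cpow_add_nat hu hs).tsum_eq_zero_add]
    simp only [Nat.cast_zero, zero_add, Nat.cast_add, Nat.cast_one]
    congr 1
    refine tsum_congr fun n => ?_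
    rw [add_assoc, add_comm u 1]

lemma isHurwitzContinuation_complexHurwitzZeta {u : ℂ} (hu : 0 < u.re) :
    IsHurwitzContinuation u (fun s => complexHurwitzZeta s u) := by
  have h := exists_isHurwitzContinuation hu
  have heq : (fun s => complexHurwitzZeta s u) = h.choose := by
    ext s
    rw [complexHurwitzZeta, dif_pos h]
  rw [heq]
  exact h.choose_spec

/-! ### Principal powers of products. -/

/-- Here `|arg z| < π/2`, so adding `arg I = π/2` does not cross the branch cut. -/
lemma I_mul_cpow {z : ℂ} (hz : 0 < z.re) (k : ℂ) :
    (Complex.I * z) ^ k = Complex.I ^ k * z ^ k := by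
  have hz0 : z ≠ 0 := fun h => by simp [h] at hz
  have harg := abs_lt.1 (Complex.abs_arg_lt_pi_div_two_iff.2 (Or.inl hz))
  have hlog : Complex.log (Complex.I * z) = Complex.log Complex.I + Complex.log z := by
    rw [Complex.log_mul_eq_add_log_iff Complex.I_ne_zero hz0, Complex.arg_I]
    constructor <;> linarith [Real.pi_pos]
  rw [Complex.cpow_def_of_ne_zero (mul_ne_zero Complex.I_ne_zero hz0),
    Complex.cpow_def_of_ne_zero Complex.I_ne_zero, Complex.cpow_def_of_ne_zero hz0, hlog, add_mul,
    Complex.exp_add]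

lemma ofReal_mul_cpow {x : ℝ} (hx : 0 < x) {z : ℂ} (hz : z ≠ 0) (k : ℂ) :
    ((x : ℂ) * z) ^ k = (x : ℂ) ^ k * z ^ k := by
  have hx0 : (x : ℂ) ≠ 0 := Complex.ofReal_ne_zero.2 hx.ne'
  rw [Complex.cpow_def_of_ne_zero (mul_ne_zero hx0 hz), Complex.cpow_def_of_ne_zero hx0,
    Complex.cpow_def_of_ne_zero hz, Complex.log_ofReal_mul hx hz, Complex.ofReal_log hx.le,
    add_mul, Complex.exp_add]

/-! ### Evaluation of the integral. -/

lemma measurable_log_tan : Measurable (fun y : ℝ => Real.log (Real.tan y)) := by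
  simp only [Real.tan_eq_sin_div_cos]
  fun_prop

lemma integrable_weight_log_tan : Integrable (fun y : ℝ => ‖(Real.cos (2 * y) : ℂ)‖ *
    (Real.exp (Real.log (Real.tan y) / 2) + Real.exp (-(Real.log (Real.tan y) / 2))))
    (volume.restrict (Ioo 0 (Real.pi / 2))) := by
  have h1 := (integrableOn_cos_two_mul_mul_exp_log_tan (w := (1 / 2 : ℝ))
    (by rw [Complex.ofReal_re]; norm_num) (by rw [Complex.ofReal_re]; norm_num)).norm
  have h2 := (integrableOn_cos_two_mul_mul_exp_log_tan (w := (-(1 / 2) : ℝ))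
    (by rw [Complex.ofReal_re]; norm_num) (by rw [Complex.ofReal_re]; norm_num)).norm
  refine (h1.add h2).congr (.of_forall fun y => ?_)
  simp only [Pi.add_apply, ← Complex.ofReal_mul _ (Real.log _), norm_mul, Complex.norm_exp,
    Complex.ofReal_re, ← mul_add]
  congr 3 <;> ring

lemma integrableOn_cos_two_mul : Integrable (fun y : ℝ => (Real.cos (2 * y) : ℂ))
    (volume.restrict (Ioo 0 (Real.pi / 2))) := by
  simpa [IntegrableOn] using integrableOn_cos_two_mul_mul_exp_log_tan (w := 0) (by simp) (by simp)

lemma integral_cos_two_mul_eq_zero :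
    ∫ y in Ioo 0 (Real.pi / 2), (Real.cos (2 * y) : ℂ) = 0 := by
  simpa using integral_cos_two_mul_mul_exp_log_tan (w := 0) (by simp) (by simp)

/-- The transform at `w = it`, with `1 / cosh` put in the geometric form with `α = π/2`, `β = π`, `ε
= -1`. -/
lemma integral_cos_two_mul_mul_exp_log_tan_mul_I (t : ℝ) :
    ∫ y in Ioo 0 (Real.pi / 2), (Real.cos (2 * y) : ℂ) *
        Complex.exp (t * Real.log (Real.tan y) * Complex.I) =
      t * (-(Real.pi * Complex.I) * (Complex.exp (-((Real.pi / 2 : ℝ) * t)) *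
        (1 - (-1) * Complex.exp (-(Real.pi * t)))⁻¹)) := by
  have h1 : ∀ y : ℝ, (t * Real.log (Real.tan y) * Complex.I : ℂ) =
    (t * Complex.I) * Real.log (Real.tan y) := fun y => by ring
  simp_rw [h1]
  rw [integral_cos_two_mul_mul_exp_log_tan (by simp) (by simp),
    show Real.pi * (t * Complex.I) / 2 = (Real.pi / 2 * t : ℂ) * Complex.I by ring,
    Complex.cos_mul_I, Complex.cosh]
  have he : Complex.exp (-(Real.pi * t : ℂ)) =
      Complex.exp (-(Real.pi / 2 * t : ℂ)) * Complex.exp (-(Real.pi / 2 * t : ℂ)) := by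
    rw [← Complex.exp_add]
    ring_nf
  have hinv : Complex.exp (Real.pi / 2 * t : ℂ) * Complex.exp (-(Real.pi / 2 * t : ℂ)) = 1 := by
    rw [← Complex.exp_add, add_neg_cancel, Complex.exp_zero]
  have hne : 1 + Complex.exp (-(Real.pi * t : ℂ)) ≠ 0 := by
    have h : (1 + Real.exp (-(Real.pi * t)) : ℝ) ≠ 0 := by positivity
    exact_mod_cast Complex.ofReal_ne_zero.2 h
  have hne' : Complex.exp (Real.pi / 2 * t : ℂ) + Complex.exp (-(Real.pi / 2 * t : ℂ)) ≠ 0 :=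
    fun h => hne <| by rw [he, ← hinv, ← add_mul, h, zero_mul]
  rw [neg_one_mul, sub_neg_eq_add, Complex.ofReal_div, Complex.ofReal_ofNat]
  rw [he, ← sq] at hne ⊢
  generalize Complex.exp (Real.pi / 2 * t : ℂ) = E at *
  generalize Complex.exp (-(Real.pi / 2 * t : ℂ)) = e at *
  field_simp
  linear_combination (t : ℂ) * hinv

/-- The terms `n = 2m` and `n = 2m + 1` have bases `2π (m + 1/4 + v/(2π))` and `2π (m + 3/4 +
v/(2π))`. -/
lemma tsum_alternating_cpow {v s : ℂ} (hv : 0 < v.re) (hs : 1 < s.re) :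
    ∑' n : ℕ, (-1 : ℂ) ^ n * (v + (Real.pi / 2 : ℝ) + n * Real.pi) ^ (-s) =
      (2 * Real.pi : ℂ) ^ (-s) *
        ((∑' n : ℕ, 1 / ((n : ℂ) + (1 / 4 + v / (2 * Real.pi))) ^ s) -
          ∑' n : ℕ, 1 / ((n : ℂ) + (3 / 4 + v / (2 * Real.pi))) ^ s) := by
  have hπ : (Real.pi : ℂ) ≠ 0 := Complex.ofReal_ne_zero.2 Real.pi_ne_zero
  have hre : 0 < (v / (2 * Real.pi)).re := by
    rw [show v / (2 * Real.pi) = ((1 / (2 * Real.pi) : ℝ) : ℂ) * v by push_cast; ring,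
      Complex.re_ofReal_mul]
    positivity
  have hre1 : 0 < (1 / 4 + v / (2 * Real.pi)).re := by
    rw [Complex.add_re]
    norm_num
    positivity
  have hre3 : 0 < (3 / 4 + v / (2 * Real.pi)).re := by
    rw [Complex.add_re]
    norm_num
    positivity
  have hscale (m : ℕ) {w : ℂ} (hw : 0 < w.re) : (2 * Real.pi * (m + w) : ℂ) ^ (-s) =
      (2 * Real.pi : ℂ) ^ (-s) * (1 / ((m : ℂ) + w) ^ s) := by
    rw [one_div, ← Complex.cpow_neg]
    have h2 : (2 * Real.pi : ℂ) = ((2 * Real.pi : ℝ) : ℂ) := by push_cast; rfl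
    have h0 : (m : ℂ) + w ≠ 0 := fun h => by
      have hre : (m : ℝ) + w.re = 0 := by simpa using congrArg Complex.re h
      linarith [Nat.cast_nonneg (α := ℝ) m]
    rw [h2, ofReal_mul_cpow (by positivity) h0]
  have h1 := ((summable_cpow_add_nat (u := 1 / 4 + v / (2 * Real.pi)) (s := s)
    hre1 hs).hasSum).mul_left ((2 * Real.pi : ℂ) ^ (-s))
  have h3 := (((summable_cpow_add_nat (u := 3 / 4 + v / (2 * Real.pi)) (s := s)
    hre3 hs).hasSum).mul_left
      ((2 * Real.pi : ℂ) ^ (-s))).neg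
  rw [mul_sub, sub_eq_add_neg]
  refine (HasSum.even_add_odd (f := fun n : ℕ => (-1 : ℂ) ^ n *
    (v + (Real.pi / 2 : ℝ) + n * Real.pi) ^ (-s)) ?_ ?_).tsum_eq
  · refine h1.congr_fun fun n => ?_
    rw [← hscale n hre1, pow_mul, neg_one_sq, one_pow, one_mul]
    congr 1
    push_cast
    field_simp
    ring
  · refine h3.congr_fun fun n => ?_
    rw [← hscale n hre3, pow_succ, pow_mul, neg_one_sq, one_pow, one_mul, neg_one_mul]
    congr 2
    push_cast
    field_simp
    ring

/-- The evaluation of `∫ cos 2y (v - i log tan y)^k` for exponents in the left half-plane. -/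
lemma integral_cos_two_mul_mul_cpow_of_re_neg {v k : ℂ} (hv : 0 < v.re) (hk : k.re < 0) :
    ∫ y in Ioo 0 (Real.pi / 2), (Real.cos (2 * y) : ℂ) *
        (v - Real.log (Real.tan y) * Complex.I) ^ k =
      (2 : ℂ) ^ (k - 1) * k * (Real.pi : ℂ) ^ k * Complex.I *
        (complexHurwitzZeta (1 - k) (1 / 4 + v / (2 * Real.pi)) -
          complexHurwitzZeta (1 - k) (3 / 4 + v / (2 * Real.pi))) := by
  have hπ : (Real.pi : ℂ) ≠ 0 := Complex.ofReal_ne_zero.2 Real.pi_ne_zero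
  have hre : 0 < (v / (2 * Real.pi)).re := by
    rw [show v / (2 * Real.pi) = ((1 / (2 * Real.pi) : ℝ) : ℂ) * v by push_cast; ring,
      Complex.re_ofReal_mul]
    positivity
  have hs : 1 < (1 - k).re := by
    rw [Complex.sub_re, Complex.one_re]
    linarith
  have h := integral_weight_mul_cpow_eq_tsum (μ := volume.restrict (Ioo 0 (Real.pi / 2)))
    (ℓ := fun y => Real.log (Real.tan y)) integrableOn_cos_two_mul
    measurable_log_tan hv hs (half_pos Real.pi_pos) Real.pi_pos
    (by simp) fun t _ => integral_cos_two_mul_mul_exp_log_tan_mul_I t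
  rw [sub_sub_cancel, tsum_alternating_cpow hv hs,
    ← (isHurwitzContinuation_complexHurwitzZeta (by rw [Complex.add_re]; norm_num; positivity)).2 _ hs,
    ← (isHurwitzContinuation_complexHurwitzZeta (by rw [Complex.add_re]; norm_num; positivity)).2 _ hs]
    at h
  rw [h, neg_sub, show (2 * Real.pi : ℂ) = (2 : ℝ) * Real.pi by push_cast; rfl,
    Complex.mul_cpow_ofReal_nonneg zero_le_two Real.pi_pos.le, Complex.cpow_sub k 1 hπ,
    Complex.cpow_one]
  push_cast
  field_simp
  ring

/-- The evaluation of `∫ cos 2y (v - i log tan y)^k`. -/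
theorem integral_cos_two_mul_mul_cpow {v : ℂ} (hv : 0 < v.re) (k : ℂ) :
    ∫ y in Ioo 0 (Real.pi / 2), (Real.cos (2 * y) : ℂ) *
        (v - Real.log (Real.tan y) * Complex.I) ^ k =
      (2 : ℂ) ^ (k - 1) * k * (Real.pi : ℂ) ^ k * Complex.I *
        (complexHurwitzZeta (1 - k) (1 / 4 + v / (2 * Real.pi)) -
          complexHurwitzZeta (1 - k) (3 / 4 + v / (2 * Real.pi))) := by
  -- At `k = 0` the factor `k` annihilates the meaningless zeta values at the pole, and the integral
  -- of `cos 2y` is zero.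
  rcases eq_or_ne k 0 with rfl | hk
  · simpa using integral_cos_two_mul_eq_zero
  have hπ : (Real.pi : ℂ) ≠ 0 := Complex.ofReal_ne_zero.2 Real.pi_ne_zero
  have hre : 0 < (v / (2 * Real.pi)).re := by
    rw [show v / (2 * Real.pi) = ((1 / (2 * Real.pi) : ℝ) : ℂ) * v by push_cast; ring,
      Complex.re_ofReal_mul]
    positivity
  have ho : IsOpen ({0}ᶜ : Set ℂ) := isOpen_compl_singleton
  have hpre : IsPreconnected ({0}ᶜ : Set ℂ) :=
    (isConnected_compl_singleton_of_one_lt_rank (by simp) (0 : ℂ)).isPreconnected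
  have hL := (differentiable_integral_weight_mul_cpow (μ := volume.restrict (Ioo 0 (Real.pi / 2)))
    (c := fun y => (Real.cos (2 * y) : ℂ)) (ℓ := fun y => Real.log (Real.tan y)) (by fun_prop)
    measurable_log_tan integrable_weight_log_tan
    hv).differentiableOn (s := {0}ᶜ)
  have hZ {u : ℂ} (hu : 0 < u.re) :
      DifferentiableOn ℂ (fun k : ℂ => complexHurwitzZeta (1 - k) u) {0}ᶜ :=
    (isHurwitzContinuation_complexHurwitzZeta hu).1.comp
      (differentiable_id.const_sub (1 : ℂ)).differentiableOn
      fun z hz h => hz (by simpa using h)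
  have hR : DifferentiableOn ℂ (fun k : ℂ => (2 : ℂ) ^ (k - 1) * k * (Real.pi : ℂ) ^ k *
      Complex.I * (complexHurwitzZeta (1 - k) (1 / 4 + v / (2 * Real.pi)) -
        complexHurwitzZeta (1 - k) (3 / 4 + v / (2 * Real.pi)))) {0}ᶜ := by
    refine DifferentiableOn.mul (Differentiable.differentiableOn fun z => ?_)
      ((hZ (by rw [Complex.add_re]; norm_num; positivity)).sub
        (hZ (by rw [Complex.add_re]; norm_num; positivity)))
    exact ((((differentiableAt_id.sub_const _).const_cpow (Or.inl two_ne_zero)).mul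
      differentiableAt_id).mul (differentiableAt_id.const_cpow (Or.inl hπ))).mul_const _
  -- The punctured plane is connected, so agreement near `-1`, inside `Re k < 0`, propagates to
  -- every `k ≠ 0`.
  refine (hL.analyticOnNhd ho).eqOn_of_preconnected_of_eventuallyEq (hR.analyticOnNhd ho) hpre
    (z₀ := -1) (by simp) ?_ hk
  filter_upwards [(isOpen_lt Complex.continuous_re continuous_const).mem_nhds
    (show (-1 : ℂ).re < 0 by simp)] with z hz
  exact integral_cos_two_mul_mul_cpow_of_re_neg hv hz

theorem mainTheorem2 (k a : ℂ) (r θ : ℝ) (hr : 0 < r) (hθ0 : 0 < θ) (hθ : θ < 2 * Real.pi)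
    (ha : a = (r : ℂ) * Complex.exp ((θ : ℂ) * Complex.I)) :
    IntervalIntegrable
      (fun y : ℝ => (Real.cos (2 * y) : ℂ) * branchLog (a * (Real.tan y : ℂ)) ^ k)
      MeasureTheory.volume 0 (Real.pi / 2) ∧
    ∫ y in (0 : ℝ)..(Real.pi / 2),
        (Real.cos (2 * y) : ℂ) * branchLog (a * (Real.tan y : ℂ)) ^ k =
      (2 : ℂ) ^ (k - 1) * k * (Real.pi : ℂ) ^ k * Complex.I ^ (k + 1) *
        (complexHurwitzZeta (1 - k) (1 / 4 - Complex.I * branchLog a / (2 * (Real.pi : ℂ))) -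
          complexHurwitzZeta (1 - k) (3 / 4 - Complex.I * branchLog a / (2 * (Real.pi : ℂ)))) := by
  set v : ℂ := -(Complex.I * branchLog a) with hv_def
  have hLa : branchLog a = Real.log r + θ * Complex.I := by
    rw [ha, branchLog_polar hr hθ0.le hθ]
  -- `Re v = θ`: the choice of argument in `(0, 2π)` is what places `v` in the right half-plane.
  have hv : 0 < v.re := by
    rw [hv_def, hLa]
    simpa using hθ0
  have hpt : ∀ y ∈ Ioo 0 (Real.pi / 2),
      (Real.cos (2 * y) : ℂ) * branchLog (a * (Real.tan y : ℂ)) ^ k =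
        Complex.I ^ k * ((Real.cos (2 * y) : ℂ) *
          (v - Real.log (Real.tan y) * Complex.I) ^ k) := fun y hy => by
    have ht : 0 < Real.tan y := Real.tan_pos_of_pos_of_lt_pi_div_two hy.1 hy.2
    have hlog : branchLog (a * (Real.tan y : ℂ)) =
        Complex.I * (v - Real.log (Real.tan y) * Complex.I) := by
      rw [ha, mul_right_comm, ← Complex.ofReal_mul, branchLog_polar (mul_pos hr ht) hθ0.le hθ,
        Real.log_mul hr.ne' ht.ne', hv_def, hLa]
      push_cast
      linear_combination ((Real.log r + θ * Complex.I + Real.log (Real.tan y)) : ℂ) *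
        Complex.I_mul_I
    rw [hlog, I_mul_cpow (by simpa using hv)]
    ring
  have hint : IntegrableOn (fun y : ℝ => (Real.cos (2 * y) : ℂ) *
      (v - Real.log (Real.tan y) * Complex.I) ^ k) (Ioo 0 (Real.pi / 2)) :=
    integrable_weight_mul_cpow (by fun_prop) measurable_log_tan
      integrable_weight_log_tan hv k
  constructor
  · rw [intervalIntegrable_iff_integrableOn_Ioo_of_le (by positivity)]
    exact IntegrableOn.congr_fun (hint.const_mul (Complex.I ^ k)) (fun y hy => (hpt y hy).symm)
      measurableSet_Ioo
  · rw [intervalIntegral.integral_of_le (by positivity), integral_Ioc_eq_integral_Ioo,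
      setIntegral_congr_fun measurableSet_Ioo hpt, integral_const_mul,
      integral_cos_two_mul_mul_cpow hv, Complex.cpow_add _ _ Complex.I_ne_zero, Complex.cpow_one,
      hv_def, neg_div, ← sub_eq_add_neg, ← sub_eq_add_neg]
    ring
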